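/- Let $n\ge 0$ be an integer. For $0\le t<1$ define the diagonal Ising form factors, in the low temperature phase (where $t=\kappa^{-2}$ with $\kappa=\sinh 2K_1\sinh 2K_2>1$ for dimensionless nearest-neighbour couplings $K_1,K_2$) for integers $p\ge 1$, by $$f^{(2p)}_{n,n}(t)=\frac{t^{p(n+p)}}{(p!)^2\pi^{2p}}\int_{(0,1)^{2p}}\prod_{k=1}^{2p}x_k^n\prod_{j=1}^{p}\left[\frac{(1-tx_{2j})(x_{2j}^{-1}-1)}{(1-tx_{2j-1})(x_{2j-1}^{-1}-1)}\right]^{1/2}\prod_{j=1}^{p}\prod_{k=1}^{p}(1-tx_{2k-1}x_{2j})^{-2}\prod_{1\le j<k\le p}(x_{2j-1}-x_{2k-1})^2(x_{2j}-x_{2k})^2\,dx,$$ and in the high temperature phase (where $t=\kappa^{2}$, $\kappa<1$) for integers $p\ge 0$, by $$f^{(2p+1)}_{n,n}(t)=\frac{t^{n(p+1/2)+p(p+1)}}{p!\,(p+1)!\,\pi^{2p+1}}\int_{(0,1)^{2p+1}}\prod_{k=1}^{2p+1}x_k^n\prod_{j=1}^{p+1}x_{2j-1}^{-1}(1-tx_{2j-1})^{-1/2}(x_{2j-1}^{-1}-1)^{-1/2}\prod_{j=1}^{p}x_{2j}(1-tx_{2j})^{1/2}(x_{2j}^{-1}-1)^{1/2}$$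 $$\times\prod_{j=1}^{p+1}\prod_{k=1}^{p}(1-tx_{2j-1}x_{2k})^{-2}\prod_{1\le j<k\le p+1}(x_{2j-1}-x_{2k-1})^2\prod_{1\le j<k\le p}(x_{2j}-x_{2k})^2\,dx .$$ These integrals converge absolutely, and there are real coefficients $c^{<}_k=c^{<}_k(n,p)$ and $c^{>}_k=c^{>}_k(n,p)$, independent of $t$, such that for all $0\le t<1$ $$f^{(2p)}_{n,n}(t)=t^{p(n+p)}\sum_{k=0}^{\infty}c^{<}_kt^k\quad(p\ge 1),\qquad f^{(2p+1)}_{n,n}(t)=t^{n(p+1/2)+p(p+1)}\sum_{k=0}^{\infty}c^{>}_kt^k\quad(p\ge 0),$$ both series being convergent. Their first two coefficients are $$c^{<}_0=\frac{1}{(p!)^2\pi^{2p}}\frac{\Gamma(n+p+\tfrac12)\Gamma(p+\tfrac12)}{\Gamma(n+\tfrac12)\Gamma(\tfrac12)}\left(\prod_{j=0}^{p-1}\frac{\Gamma(n+j+\tfrac12)\Gamma(j+\tfrac12)\Gamma(j+2)}{\Gamma(n+p+j+1)}\right)^2,$$ $$c^{<}_1=c^{<}_0\,\frac{p(n+p)}{2(n+2p)^2}\,[4p(n+p)+1],$$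 $$c^{>}_0=\frac{1}{p!\,\pi^{2p+1}}\frac{\Gamma(n+\tfrac12)\Gamma(\tfrac12)}{\Gamma(n+p+1)}\left(\prod_{j=0}^{p-1}\frac{\Gamma(n+j+\tfrac32)\Gamma(j+\tfrac32)\Gamma(j+2)}{\Gamma(n+p+j+2)}\right)^2,$$ $$c^{>}_1=c^{>}_0\,\frac{n+p+\tfrac12}{2(n+2p+1)^2}\,\bigl[4p(p+1)(n+p+\tfrac12)+n+2p+1\bigr].$$ -/

import Mathlib

namespace IsingDiagonal

/-- The open unit cube `(0,1)^m`. -/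
def unitCube (m : ℕ) : Set (Fin m → ℝ) := Set.univ.pi fun _ => Set.Ioo (0 : ℝ) 1

/-- The integrand of the `2p`-fold integral for the low temperature form factor `f^{(2p)}_{n,n}`.
The variables of odd index `x_1, x_3, …, x_{2p-1}` are collected in `z.1 = u` and those of
even index `x_2, x_4, …, x_{2p}` in `z.2 = v`, so `u_j = x_{2j-1}` and `v_j = x_{2j}`. -/
noncomputable def lowIntegrand (n p : ℕ) (t : ℝ) (z : (Fin p → ℝ) × (Fin p → ℝ)) : ℝ :=
  (∏ j, z.1 j ^ n) * (∏ j, z.2 j ^ n) *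
  (∏ j, (((1 - t * z.2 j) * ((z.2 j)⁻¹ - 1)) /
      ((1 - t * z.1 j) * ((z.1 j)⁻¹ - 1))) ^ (1 / 2 : ℝ)) *
  (∏ j, ∏ k, ((1 - t * z.1 k * z.2 j) ^ 2)⁻¹) *
  ∏ j, ∏ k ∈ Finset.Ioi j, (z.1 j - z.1 k) ^ 2 * (z.2 j - z.2 k) ^ 2

/-- The low temperature diagonal form factor `f^{(2p)}_{n,n}` as a function of `t`. -/
noncomputable def lowFormFactor (n p : ℕ) (t : ℝ) : ℝ :=
  t ^ (p * (n + p)) / ((p.factorial : ℝ) ^ 2 * Real.pi ^ (2 * p)) *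
    ∫ z in unitCube p ×ˢ unitCube p, lowIntegrand n p t z

/-- The integrand of the `(2p+1)`-fold integral for the high temperature form factor
`f^{(2p+1)}_{n,n}`.  The variables of odd index `x_1, x_3, …, x_{2p+1}` are collected in
`z.1 = u` and those of even index `x_2, x_4, …, x_{2p}` in `z.2 = v`. -/
noncomputable def highIntegrand (n p : ℕ) (t : ℝ) (z : (Fin (p + 1) → ℝ) × (Fin p → ℝ)) : ℝ :=
  (∏ j, z.1 j ^ n) * (∏ j, z.2 j ^ n) *
  (∏ j, (z.1 j)⁻¹ * (1 - t * z.1 j) ^ (-(1 / 2) : ℝ) * ((z.1 j)⁻¹ - 1) ^ (-(1 / 2) : ℝ)) *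
  (∏ j, z.2 j * (1 - t * z.2 j) ^ (1 / 2 : ℝ) * ((z.2 j)⁻¹ - 1) ^ (1 / 2 : ℝ)) *
  (∏ j, ∏ k, ((1 - t * z.1 j * z.2 k) ^ 2)⁻¹) *
  (∏ j, ∏ k ∈ Finset.Ioi j, (z.1 j - z.1 k) ^ 2) *
  ∏ j, ∏ k ∈ Finset.Ioi j, (z.2 j - z.2 k) ^ 2

/-- The high temperature diagonal form factor `f^{(2p+1)}_{n,n}` as a function of `t`. -/
noncomputable def highFormFactor (n p : ℕ) (t : ℝ) : ℝ :=
  t ^ ((n : ℝ) * (p + 1 / 2) + p * (p + 1)) /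
      ((p.factorial : ℝ) * ((p + 1).factorial : ℝ) * Real.pi ^ (2 * p + 1)) *
    ∫ z in unitCube (p + 1) ×ˢ unitCube p, highIntegrand n p t z

end IsingDiagonal

/-! On the cube the integrand is a product of two Selberg densities `∏ x^(a-1) (1-x)^(b-1) ·
Δ(x)^2`, one in `u` and one in `v`, times the interaction `∏ (1-tu)^(-1/2) ∏ (1-tv)^(1/2) ∏
(1-tuv)^(-2)`, which carries all the dependence on `t`. Each interaction factor is a binomial series
in `t`, bounded on the cube by the series of absolute values of its coefficients, which converges
for `t < 1`. Dominated convergence therefore gives integrability and termwise integration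
(`HasUniformExpansion.exists_hasSum_integral`).

Up to the prefactor, `c 0` is a product of two Selberg integrals. The linear term of the interaction
is `½ Σu - ½ Σv + 2 (Σu)(Σv)`, so by Fubini `c 1 / c 0 = e/2 - e'/2 + 2ee'`, with `e`, `e'` the
means of `Σu`, `Σv` under the two densities.

With exponent 2 on the Vandermonde product, both ingredients follow from orthogonal polynomials.
Writing `Δ` as a determinant of monic Jacobi polynomials turns the integral into `N!` times a
product of norms (`integral_selbergWeight`), and the mean into a telescoping sum of recurrence
coefficients (`integral_sum_mul_selbergWeight`). Norms and subleading coefficients come from the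
Rodrigues shift `(a, b) → (a+1, b+1)`. -/

namespace IsingDiagonal

open MeasureTheory ProbabilityTheory Polynomial

/-! ### Beta weights and their moments -/

/-- The unnormalised beta density `x ^ (a - 1) * (1 - x) ^ (b - 1)`. -/
noncomputable def betaWeight (a b x : ℝ) : ℝ := x ^ (a - 1) * (1 - x) ^ (b - 1)

/-- Lebesgue measure on the open unit interval. -/
noncomputable abbrev unitMeasure : Measure ℝ := volume.restrict (Set.Ioo 0 1)

lemma betaWeight_pos {a b x : ℝ} (hx : x ∈ Set.Ioo (0 : ℝ) 1) : 0 < betaWeight a b x :=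
  mul_pos (Real.rpow_pos_of_pos hx.1 _) (Real.rpow_pos_of_pos (by linarith [hx.2]) _)

lemma integrable_betaWeight {a b : ℝ} (ha : 0 < a) (hb : 0 < b) :
    Integrable (betaWeight a b) unitMeasure := by
  have h := Complex.betaIntegral_convergent (u := a) (v := b) (by simpa) (by simpa)
  rw [intervalIntegrable_iff_integrableOn_Ioo_of_le (by simp)] at h
  refine IntegrableOn.congr_fun h.norm (fun x hx => ?_) measurableSet_Ioo
  have h1 : (0 : ℝ) < 1 - x := by linarith [hx.2]
  have e1 : ‖(x : ℂ) ^ ((a : ℂ) - 1)‖ = x ^ (a - 1) := by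
    rw [Complex.norm_cpow_eq_rpow_re_of_pos hx.1]; simp
  have e2 : ‖(1 - (x : ℂ)) ^ ((b : ℂ) - 1)‖ = (1 - x) ^ (b - 1) := by
    have := Complex.norm_cpow_eq_rpow_re_of_pos h1 ((b : ℂ) - 1)
    simpa using this
  simp only [norm_mul, e1, e2, betaWeight]

lemma integral_betaWeight {a b : ℝ} (ha : 0 < a) (hb : 0 < b) :
    ∫ x, betaWeight a b x ∂unitMeasure = beta a b := by
  have h := lintegral_betaPDF_eq_one ha hb
  rw [lintegral_betaPDF, ← ENNReal.toReal_eq_one_iff, ← integral_eq_lintegral_of_nonneg_ae] at h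
  · simp_rw [mul_assoc, integral_const_mul] at h
    have := (beta_pos ha hb).ne'
    field_simp at h
    exact h
  · refine ae_restrict_of_forall_mem measurableSet_Ioo (fun x hx ↦ ?_)
    have h1 := betaWeight_pos (a := a) (b := b) hx
    have h2 := (beta_pos ha hb)
    unfold betaWeight at h1
    change 0 ≤ 1 / beta a b * x ^ (a - 1) * (1 - x) ^ (b - 1)
    rw [mul_assoc]
    positivity
  · exact Measurable.aestronglyMeasurable (by fun_prop)

lemma beta_add_one_left {a b : ℝ} (ha : 0 < a) (hb : 0 < b) :
    (a + b) * beta (a + 1) b = a * beta a b := by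
  have h := (Real.Gamma_pos_of_pos (add_pos ha hb)).ne'
  have h2 := (add_pos ha hb).ne'
  unfold beta
  rw [show a + 1 + b = a + b + 1 by ring, Real.Gamma_add_one ha.ne', Real.Gamma_add_one h2]
  field_simp

lemma beta_add_one_right {a b : ℝ} (ha : 0 < a) (hb : 0 < b) :
    beta a (b + 1) = beta a b - beta (a + 1) b := by
  have h := (Real.Gamma_pos_of_pos (add_pos ha hb)).ne'
  have h2 := (add_pos ha hb).ne'
  unfold beta
  rw [show a + 1 + b = a + b + 1 by ring, ← add_assoc, Real.Gamma_add_one ha.ne',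
    Real.Gamma_add_one h2, Real.Gamma_add_one hb.ne']
  field_simp
  ring

/-- The linear functional on polynomials with moments `beta (a + m) b`. -/
noncomputable def betaFunctional (a b : ℝ) : ℝ[X] →ₗ[ℝ] ℝ :=
  Polynomial.lsum fun m => beta (a + m) b • LinearMap.id

lemma betaFunctional_monomial (a b c : ℝ) (m : ℕ) :
    betaFunctional a b (monomial m c) = beta (a + m) b * c := by
  simp [betaFunctional, Polynomial.lsum_apply, Polynomial.sum_monomial_index]

lemma betaWeight_mul_pow {a b x : ℝ} (hx : 0 < x) (m : ℕ) :
    x ^ m * betaWeight a b x = betaWeight (a + m) b x := by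
  unfold betaWeight
  rw [show a + m - 1 = a - 1 + m by ring, Real.rpow_add_natCast hx.ne']
  ring

lemma integrable_eval_mul_betaWeight {a b : ℝ} (ha : 0 < a) (hb : 0 < b) (q : ℝ[X]) :
    Integrable (fun x => q.eval x * betaWeight a b x) unitMeasure := by
  induction q using Polynomial.induction_on' with
  | add p q hp hq => simp only [eval_add, add_mul]; exact hp.add hq
  | monomial m c =>
    have h := (integrable_betaWeight (a := a + m) (by positivity) hb).const_mul c
    refine IntegrableOn.congr_fun h (fun x hx => ?_) measurableSet_Ioo
    simp [← betaWeight_mul_pow hx.1, mul_assoc]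

/-- Lets the orthogonality theory be done algebraically on moments, with analysis needed only here.
-/
lemma integral_eval_mul_betaWeight {a b : ℝ} (ha : 0 < a) (hb : 0 < b) (q : ℝ[X]) :
    ∫ x, q.eval x * betaWeight a b x ∂unitMeasure = betaFunctional a b q := by
  induction q using Polynomial.induction_on' with
  | add p q hp hq =>
    simp only [eval_add, add_mul, map_add]
    rw [integral_add (integrable_eval_mul_betaWeight ha hb p)
      (integrable_eval_mul_betaWeight ha hb q), hp, hq]
  | monomial m c =>
    rw [betaFunctional_monomial, ← integral_betaWeight (by positivity) hb, ← integral_mul_const]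
    refine setIntegral_congr_fun measurableSet_Ioo (fun x hx => ?_)
    simp only [← betaWeight_mul_pow hx.1, eval_monomial]
    ring

lemma betaFunctional_shift {a b : ℝ} (ha : 0 < a) (hb : 0 < b) (q : ℝ[X]) :
    betaFunctional (a + 1) (b + 1) q = betaFunctional a b (X * (1 - X) * q) := by
  induction q using Polynomial.induction_on' with
  | add p q hp hq => simp only [mul_add, map_add, hp, hq]
  | monomial m c =>
    have e : X * (1 - X) * monomial m c = monomial (m + 1) c - monomial (m + 2) c := by
      simp only [← C_mul_X_pow_eq_monomial]; ring
    rw [e, map_sub]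
    simp only [betaFunctional_monomial]
    rw [beta_add_one_right (by positivity) hb]
    push_cast
    rw [show a + 1 + m = a + (m + 1) by ring, show a + (m + 1 : ℝ) + 1 = a + (m + 2) by ring]
    ring

/-- Moment form of `∫ (x(1-x) w q)' = 0` for the beta weight `w`, since `(x(1-x) w)' = (a - (a+b)x)
w`. On monomials it is the recurrence `beta_add_one_left`, so no boundary terms arise. -/
lemma betaFunctional_integration_by_parts {a b : ℝ} (ha : 0 < a) (hb : 0 < b) (q : ℝ[X]) :
    betaFunctional a b (X * (1 - X) * derivative q + (C a - C (a + b) * X) * q) = 0 := by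
  induction q using Polynomial.induction_on' with
  | add p q hp hq =>
    rw [← add_zero (0 : ℝ)]
    nth_rewrite 2 [← hp]
    rw [← hq, ← map_add, derivative_add]
    congr 1
    ring
  | monomial m c =>
    have e : X * (1 - X) * derivative (monomial m c) + (C a - C (a + b) * X) * monomial m c
        = monomial m ((a + m) * c) - monomial (m + 1) ((a + m + b) * c) := by
      rcases m with _ | m
      · simp only [← C_mul_X_pow_eq_monomial, map_mul, map_add]; simp; ring
      · rw [derivative_monomial]
        simp only [← C_mul_X_pow_eq_monomial, map_mul, map_add, Nat.add_sub_cancel]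
        push_cast
        ring
    rw [e, map_sub]
    simp only [betaFunctional_monomial]
    have h := beta_add_one_left (a := a + m) (b := b) (by positivity) hb
    push_cast
    rw [← add_assoc]
    linear_combination -c * h

/-! ### Monic Jacobi polynomials -/

/-- The monic Jacobi polynomials on the unit interval, by the shift recursion that underlies
Rodrigues' formula. -/
noncomputable def jacobi : ℕ → ℝ → ℝ → ℝ[X]
  | 0, _, _ => 1
  | k + 1, a, b => C (-(a + b + k)⁻¹) * (X * (1 - X) * derivative (jacobi k (a + 1) (b + 1)) +
      (C a - C (a + b) * X) * jacobi k (a + 1) (b + 1))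

/-- The squared norm of `jacobi k a b`, see `betaFunctional_jacobi_mul`. -/
noncomputable def jacobiNorm : ℕ → ℝ → ℝ → ℝ
  | 0, a, b => beta a b
  | k + 1, a, b => (k + 1) / (a + b + k) * jacobiNorm k (a + 1) (b + 1)

/-- The recursion makes `jacobi (k+1) a b` times the weight an exact derivative, up to a scalar.
Integrating by parts moves that derivative onto `q`, and `x(1-x)` raises both weight parameters by
one. -/
lemma betaFunctional_jacobi_succ_mul {a b : ℝ} (ha : 0 < a) (hb : 0 < b) (k : ℕ) (q : ℝ[X]) :
    betaFunctional a b (jacobi (k + 1) a b * q) = (a + b + k)⁻¹ *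
      betaFunctional (a + 1) (b + 1) (jacobi k (a + 1) (b + 1) * derivative q) := by
  have h := betaFunctional_integration_by_parts ha hb (jacobi k (a + 1) (b + 1) * q)
  have e : jacobi (k + 1) a b * q =
      (a + b + k)⁻¹ • (X * (1 - X) * (jacobi k (a + 1) (b + 1) * derivative q)) -
      (a + b + k)⁻¹ • (X * (1 - X) * derivative (jacobi k (a + 1) (b + 1) * q) +
        (C a - C (a + b) * X) * (jacobi k (a + 1) (b + 1) * q)) := by
    rw [jacobi, derivative_mul, smul_eq_C_mul, smul_eq_C_mul, map_neg]
    ring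
  rw [e, map_sub, map_smul, map_smul, h, betaFunctional_shift ha hb, smul_zero, sub_zero,
    smul_eq_mul]

lemma betaFunctional_jacobi_mul (k : ℕ) {a b : ℝ} (ha : 0 < a) (hb : 0 < b) (q : ℝ[X])
    (hq : q.natDegree ≤ k) :
    betaFunctional a b (jacobi k a b * q) = q.coeff k * jacobiNorm k a b := by
  induction k generalizing a b q with
  | zero =>
    rw [eq_C_of_natDegree_le_zero hq, ← monomial_zero_left]
    simp only [jacobi, one_mul, betaFunctional_monomial, jacobiNorm]
    simp [mul_comm]
  | succ k ih =>
    rw [betaFunctional_jacobi_succ_mul ha hb, ih (by positivity) (by positivity) _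
      ((natDegree_derivative_le q).trans (by omega)), coeff_derivative, jacobiNorm]
    ring

lemma natDegree_jacobi_le (k : ℕ) (a b : ℝ) : (jacobi k a b).natDegree ≤ k := by
  induction k generalizing a b with
  | zero => simp [jacobi]
  | succ k ih =>
    have h1 := ih (a + 1) (b + 1)
    rw [jacobi]
    refine (natDegree_C_mul_le _ _).trans ?_
    rcases k with _ | k
    · simp only [jacobi, derivative_one, mul_zero, zero_add, mul_one]
      compute_degree
    · have h2 : (derivative (jacobi (k + 1) (a + 1) (b + 1))).natDegree ≤ k :=
        (natDegree_derivative_le _).trans (by omega)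
      have h3 : (X * (1 - X) : ℝ[X]).natDegree ≤ 2 := by compute_degree
      have h4 : (C a - C (a + b) * X : ℝ[X]).natDegree ≤ 1 := by compute_degree
      exact natDegree_add_le_of_degree_le
        (natDegree_mul_le.trans (by omega)) (natDegree_mul_le.trans (by omega))

lemma coeff_jacobi_succ (k m : ℕ) (a b : ℝ) :
    (jacobi (k + 1) a b).coeff (m + 1) = -(a + b + k)⁻¹ *
      ((m + 1 + a) * (jacobi k (a + 1) (b + 1)).coeff (m + 1)
        - (m + a + b) * (jacobi k (a + 1) (b + 1)).coeff m) := by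
  set P := jacobi k (a + 1) (b + 1) with hP
  have e : X * (1 - X) * derivative P + (C a - C (a + b) * X) * P
      = X * derivative P - X * (X * derivative P) + (C a * P - C (a + b) * (X * P)) := by ring
  rw [jacobi, ← hP, e]
  rcases m with _ | m <;>
  · simp only [coeff_C_mul, coeff_add, coeff_sub, coeff_X_mul, coeff_derivative, coeff_X_mul_zero]
    push_cast
    ring

lemma coeff_jacobi_self (k : ℕ) {a b : ℝ} (ha : 0 < a) (hb : 0 < b) :
    (jacobi k a b).coeff k = 1 := by
  induction k generalizing a b with
  | zero => simp [jacobi]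
  | succ k ih =>
    rw [coeff_jacobi_succ, ih (by positivity) (by positivity),
      coeff_eq_zero_of_natDegree_lt (Nat.lt_succ_of_le (natDegree_jacobi_le _ _ _))]
    have : a + b + k ≠ 0 := by positivity
    have : k + a + b ≠ 0 := by positivity
    field_simp
    ring

/-- Multiplying by `X` names the subleading coefficient without the subtraction `k - 1`, and makes
it `0` at `k = 0`. -/
lemma coeff_jacobi_sub (k : ℕ) {a b : ℝ} (ha : 0 < a) (hb : 0 < b) :
    (X * jacobi k a b).coeff k = -(k * (a + k - 1) / (a + b + 2 * k - 2)) := by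
  induction k generalizing a b with
  | zero => simp
  | succ k ih =>
    have h0 : a + b ≠ 0 := by positivity
    have h1 : a + b + k ≠ 0 := by positivity
    have h2 : a + b + 2 * k ≠ 0 := by positivity
    rw [coeff_X_mul]
    rcases k with _ | k
    · simp only [jacobi, derivative_one, mul_zero, mul_one, coeff_C_mul, coeff_sub, zero_add,
        coeff_C_zero, coeff_mul_X_zero, Nat.cast_zero, Nat.cast_one]
      simp only [add_zero, sub_zero, one_mul, add_sub_cancel_right]
      ring
    · have := ih (a := a + 1) (b := b + 1) (by positivity) (by positivity)
      rw [coeff_X_mul] at this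
      rw [coeff_jacobi_succ, this, coeff_jacobi_self _ (by positivity) (by positivity)]
      push_cast at h1 h2 ⊢
      rw [show a + 1 + (b + 1) + 2 * ((k : ℝ) + 1) - 2 = a + b + 2 * (k + 1) by ring,
        show a + b + 2 * ((k : ℝ) + 1 + 1) - 2 = a + b + 2 * (k + 1) by ring, neg_mul, neg_inj,
        inv_mul_eq_div, div_eq_div_iff h1 h2]
      field_simp
      ring

lemma monic_jacobi (k : ℕ) {a b : ℝ} (ha : 0 < a) (hb : 0 < b) : (jacobi k a b).Monic :=
  monic_of_natDegree_le_of_coeff_eq_one k (natDegree_jacobi_le k a b) (coeff_jacobi_self k ha hb)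

lemma natDegree_jacobi (k : ℕ) {a b : ℝ} (ha : 0 < a) (hb : 0 < b) :
    (jacobi k a b).natDegree = k :=
  le_antisymm (natDegree_jacobi_le k a b)
    (le_natDegree_of_ne_zero (by rw [coeff_jacobi_self k ha hb]; exact one_ne_zero))

lemma betaFunctional_jacobi_mul_jacobi {a b : ℝ} (ha : 0 < a) (hb : 0 < b) (i j : ℕ) :
    betaFunctional a b (jacobi i a b * jacobi j a b) = if i = j then jacobiNorm i a b else 0 := by
  rcases lt_trichotomy i j with h | rfl | h
  · rw [mul_comm, betaFunctional_jacobi_mul j ha hb _ ((natDegree_jacobi_le i a b).trans h.le),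
      coeff_eq_zero_of_natDegree_lt ((natDegree_jacobi_le i a b).trans_lt h), if_neg h.ne, zero_mul]
  · rw [betaFunctional_jacobi_mul i ha hb _ (natDegree_jacobi_le i a b),
      coeff_jacobi_self i ha hb, if_pos rfl, one_mul]
  · rw [betaFunctional_jacobi_mul i ha hb _ ((natDegree_jacobi_le j a b).trans h.le),
      coeff_eq_zero_of_natDegree_lt ((natDegree_jacobi_le j a b).trans_lt h), if_neg h.ne', zero_mul]

/-- Diagonal coefficient of the three-term recurrence: `X * jacobi j` and `jacobi (j+1)` are both
monic of degree `j+1`, so their difference has degree at most `j` and only its coefficient at `j`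
pairs with `jacobi j`. -/
lemma betaFunctional_X_mul_jacobi_sq {a b : ℝ} (ha : 0 < a) (hb : 0 < b) (j : ℕ) :
    betaFunctional a b (X * (jacobi j a b * jacobi j a b)) =
      ((X * jacobi j a b).coeff j - (X * jacobi (j + 1) a b).coeff (j + 1)) *
        jacobiNorm j a b := by
  have e : X * (jacobi j a b * jacobi j a b) = jacobi j a b * (X * jacobi j a b - jacobi (j + 1) a b)
      + jacobi j a b * jacobi (j + 1) a b := by ring
  have hd : (X * jacobi j a b - jacobi (j + 1) a b).natDegree ≤ j := by
    rw [natDegree_le_iff_coeff_eq_zero]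
    intro N hN
    obtain ⟨N, rfl⟩ : ∃ M, N = M + 1 := ⟨N - 1, by omega⟩
    rw [coeff_sub, coeff_X_mul]
    rcases (Nat.lt_succ_iff.mp hN).eq_or_lt with rfl | h
    · rw [coeff_jacobi_self _ ha hb, coeff_jacobi_self _ ha hb, sub_self]
    · rw [coeff_eq_zero_of_natDegree_lt ((natDegree_jacobi_le j a b).trans_lt h),
        coeff_eq_zero_of_natDegree_lt ((natDegree_jacobi_le (j + 1) a b).trans_lt (by omega)),
        sub_self]
  rw [e, map_add, betaFunctional_jacobi_mul_jacobi ha hb, if_neg (by omega), add_zero,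
    betaFunctional_jacobi_mul j ha hb _ hd, coeff_sub, coeff_X_mul]

/-! ### Norms as Gamma quotients -/

lemma Gamma_mul_prod_add {x : ℝ} (hx : 0 < x) (k : ℕ) :
    Real.Gamma x * ∏ i ∈ Finset.range k, (x + i) = Real.Gamma (x + k) := by
  induction k with
  | zero => simp
  | succ k ih =>
    rw [Finset.prod_range_succ, ← mul_assoc, ih, Nat.cast_succ, ← add_assoc,
      Real.Gamma_add_one (by positivity)]
    ring

/-- The finite product stands for `Γ(a+b+k-1) / Γ(a+b+2k-1)`, which degenerates at `k = 0` when `a +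
b = 1`. -/
lemma jacobiNorm_eq_prod (k : ℕ) {a b : ℝ} :
    jacobiNorm k a b = k.factorial * Real.Gamma (a + k) * Real.Gamma (b + k) /
      Real.Gamma (a + b + 2 * k) * ∏ i ∈ Finset.range k, (a + b + k - 1 + i)⁻¹ := by
  induction k generalizing a b with
  | zero => simp [jacobiNorm, beta]
  | succ k ih =>
    rw [jacobiNorm, ih, Finset.prod_range_succ', Nat.factorial_succ]
    have e : ∏ i ∈ Finset.range k, (a + 1 + (b + 1) + k - 1 + i)⁻¹ =
        ∏ i ∈ Finset.range k, (a + b + ((k + 1 : ℕ) : ℝ) - 1 + ((i + 1 : ℕ) : ℝ))⁻¹ := by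
      refine Finset.prod_congr rfl fun i _ => ?_
      push_cast
      congr 1
      ring
    rw [e]
    push_cast
    rw [show a + 1 + k = a + (k + 1 : ℝ) by ring, show b + 1 + k = b + (k + 1 : ℝ) by ring,
      show a + 1 + (b + 1) + 2 * k = a + b + 2 * (k + 1 : ℝ) by ring,
      show a + b + (k + 1 : ℝ) - 1 + 0 = a + b + k by ring]
    ring

lemma prod_jacobiNorm (N : ℕ) {a b : ℝ} (ha : 0 < a) (hb : 0 < b) :
    ∏ k ∈ Finset.range N, jacobiNorm k a b =
      ∏ j ∈ Finset.range N, Real.Gamma (a + j) * Real.Gamma (b + j) * j.factorial /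
        Real.Gamma (a + b + N - 1 + j) := by
  induction N with
  | zero => simp
  | succ N ih =>
    rw [Finset.prod_range_succ, ih]
    -- The step to `N = 1` is separate: the general argument would involve `Γ(a+b-1)`, possibly at a
    -- pole. The case `a + b = 1` does occur, at high temperature with `n = 0`.
    rcases N with _ | N
    · simp [jacobiNorm, beta]
    have hG : ∀ j : ℕ, Real.Gamma (a + b + N + j) ≠ 0 := fun j =>
      (Real.Gamma_pos_of_pos (by positivity)).ne'
    have h1 := Gamma_mul_prod_add (x := a + b + N) (by positivity) (N + 1)
    have h2 : (∏ i ∈ Finset.range (N + 1), (a + b + ((N + 1 : ℕ) : ℝ) - 1 + i)⁻¹) =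
        Real.Gamma (a + b + N) / Real.Gamma (a + b + N + (N + 1 : ℕ)) := by
      rw [← h1, Finset.prod_inv_distrib]
      have := hG 0
      simp only [Nat.cast_zero, add_zero] at this
      rw [div_mul_eq_div_div, div_self this, one_div]
      congr 1
      refine Finset.prod_congr rfl fun i _ => ?_
      push_cast; ring
    rw [jacobiNorm_eq_prod, h2]
    simp only [Finset.prod_div_distrib]
    have h3 : ∏ x ∈ Finset.range (N + 1), Real.Gamma (a + b + ((N + 1 : ℕ) : ℝ) - 1 + x)
        = ∏ x ∈ Finset.range (N + 1), Real.Gamma (a + b + N + x) := by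
      refine Finset.prod_congr rfl fun i _ => ?_
      congr 1; push_cast; ring
    -- Raising `N` shifts every denominator argument by one, so the old and new products differ only
    -- in their end factors.
    have h4 : (∏ x ∈ Finset.range (N + 1 + 1), Real.Gamma (a + b + ((N + 1 + 1 : ℕ) : ℝ) - 1 + x))
        * Real.Gamma (a + b + N) = (∏ x ∈ Finset.range (N + 1), Real.Gamma (a + b + N + x)) *
          Real.Gamma (a + b + N + (N + 1 : ℕ)) * Real.Gamma (a + b + 2 * (N + 1 : ℕ)) := by
      rw [← Finset.prod_range_succ (fun x => Real.Gamma (a + b + N + x)),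
        Finset.prod_range_succ (fun x : ℕ => Real.Gamma (a + b + ((N + 1 + 1 : ℕ) : ℝ) - 1 + x)),
        Finset.prod_range_succ' (fun x : ℕ => Real.Gamma (a + b + N + x))]
      have : ∏ x ∈ Finset.range (N + 1), Real.Gamma (a + b + ((N + 1 + 1 : ℕ) : ℝ) - 1 + x)
         = ∏ x ∈ Finset.range (N + 1), Real.Gamma (a + b + N + (x + 1 : ℕ)) := by
        refine Finset.prod_congr rfl fun i _ => ?_
        congr 1; push_cast; ring
      rw [this]
      push_cast
      rw [show a + b + (N + 1 + 1 : ℝ) - 1 + (N + 1) = a + b + 2 * (N + 1) by ring, add_zero]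
      ring
    have n1 : ∏ x ∈ Finset.range (N + 1), Real.Gamma (a + b + N + x) ≠ 0 :=
      Finset.prod_ne_zero_iff.mpr fun i _ => hG i
    have n2 : ∏ x ∈ Finset.range (N + 1 + 1),
        Real.Gamma (a + b + ((N + 1 + 1 : ℕ) : ℝ) - 1 + x) ≠ 0 := by
      refine Finset.prod_ne_zero_iff.mpr fun i _ => ?_
      refine (Real.Gamma_pos_of_pos ?_).ne'
      push_cast
      have : a + b + (N + 1 + 1 : ℝ) - 1 + i = a + b + N + 1 + i := by ring
      rw [this]; positivity
    have n3 : Real.Gamma (a + b + 2 * (N + 1 : ℕ)) ≠ 0 :=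
      (Real.Gamma_pos_of_pos (by positivity)).ne'
    have n4 := hG (N + 1)
    rw [h3, Finset.prod_range_succ (fun x : ℕ => Real.Gamma (a + x) * Real.Gamma (b + x) *
      (x.factorial : ℝ)) (N + 1), div_mul_div_comm, div_mul_div_comm, div_eq_div_iff (by positivity) n2]
    linear_combination (∏ x ∈ Finset.range (N + 1), Real.Gamma (a + x) * Real.Gamma (b + x) *
      (x.factorial : ℝ)) * ((N + 1).factorial * Real.Gamma (a + (N + 1 : ℕ)) *
        Real.Gamma (b + (N + 1 : ℕ))) * h4

/-! ### Selberg integral and first Aomoto moment -/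

/-- The squared Vandermonde determinant. -/
noncomputable def vandermondeSq {N : ℕ} (x : Fin N → ℝ) : ℝ :=
  ∏ i, ∏ j ∈ Finset.Ioi i, (x i - x j) ^ 2

/-- The integrand of the Selberg integral at `γ = 1`. -/
noncomputable def selbergWeight {N : ℕ} (a b : ℝ) (x : Fin N → ℝ) : ℝ :=
  (∏ i, betaWeight a b (x i)) * vandermondeSq x

/-- Lebesgue measure on the open unit cube. -/
noncomputable abbrev cubeMeasure (N : ℕ) : Measure (Fin N → ℝ) := Measure.pi fun _ => unitMeasure

/-- Column operations replace the powers in the Vandermonde matrix by any monic polynomials of the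
same degrees. -/
lemma vandermondeSq_eq_sum {N : ℕ} {a b : ℝ} (ha : 0 < a) (hb : 0 < b) (x : Fin N → ℝ) :
    vandermondeSq x = ∑ σ : Equiv.Perm (Fin N), ∑ τ : Equiv.Perm (Fin N),
      ((Equiv.Perm.sign σ : ℤ) : ℝ) * ((Equiv.Perm.sign τ : ℤ) : ℝ) *
        ∏ i, (jacobi (σ i) a b * jacobi (τ i) a b).eval (x i) := by
  have h1 : vandermondeSq x = (Matrix.vandermonde x).det ^ 2 := by
    rw [Matrix.det_vandermonde, vandermondeSq, ← Finset.prod_pow]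
    refine Finset.prod_congr rfl fun i _ => ?_
    rw [← Finset.prod_pow]
    exact Finset.prod_congr rfl fun j _ => by ring
  rw [h1, Matrix.det_eval_matrixOfPolynomials_eq_det_vandermonde x (fun j => jacobi j a b)
    (fun i => natDegree_jacobi i ha hb) (fun i => monic_jacobi i ha hb), ← Matrix.det_transpose,
    Matrix.det_apply', sq, Finset.sum_mul_sum]
  refine Finset.sum_congr rfl fun σ _ => Finset.sum_congr rfl fun τ _ => ?_
  simp only [Matrix.transpose_apply, Matrix.of_apply, eval_mul, Finset.prod_mul_distrib]
  ring

/-- The factors `f` serve both integrals: `f = 1` gives Selberg's, and `X` in a single slot gives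
the first moment. -/
lemma prod_eval_mul_selbergWeight_eq_sum {N : ℕ} {a b : ℝ} (ha : 0 < a) (hb : 0 < b)
    (f : Fin N → ℝ[X]) (x : Fin N → ℝ) :
    (∏ i, (f i).eval (x i)) * selbergWeight a b x =
      ∑ σ : Equiv.Perm (Fin N), ∑ τ : Equiv.Perm (Fin N),
      ((Equiv.Perm.sign σ : ℤ) : ℝ) * ((Equiv.Perm.sign τ : ℤ) : ℝ) *
        ∏ i, ((f i * (jacobi (σ i) a b * jacobi (τ i) a b)).eval (x i) *
          betaWeight a b (x i)) := by
  rw [selbergWeight, vandermondeSq_eq_sum ha hb, Finset.mul_sum, Finset.mul_sum]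
  refine Finset.sum_congr rfl fun σ _ => ?_
  rw [Finset.mul_sum, Finset.mul_sum]
  refine Finset.sum_congr rfl fun τ _ => ?_
  simp only [eval_mul, Finset.prod_mul_distrib]
  ring

lemma integrable_prod_eval_mul_betaWeight {N : ℕ} {a b : ℝ} (ha : 0 < a) (hb : 0 < b)
    (q : Fin N → ℝ[X]) :
    Integrable (fun x : Fin N → ℝ => ∏ i, ((q i).eval (x i) * betaWeight a b (x i)))
      (cubeMeasure N) :=
  Integrable.fintype_prod fun i => integrable_eval_mul_betaWeight ha hb (q i)

lemma integrable_prod_eval_mul_selbergWeight {N : ℕ} {a b : ℝ} (ha : 0 < a) (hb : 0 < b)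
    (f : Fin N → ℝ[X]) :
    Integrable (fun x : Fin N → ℝ => (∏ i, (f i).eval (x i)) * selbergWeight a b x)
      (cubeMeasure N) := by
  simp only [prod_eval_mul_selbergWeight_eq_sum ha hb]
  exact integrable_finsetSum _ fun σ _ => integrable_finsetSum _ fun τ _ =>
    (integrable_prod_eval_mul_betaWeight ha hb _).const_mul _

lemma integral_prod_eval_mul_selbergWeight {N : ℕ} {a b : ℝ} (ha : 0 < a) (hb : 0 < b)
    (f : Fin N → ℝ[X]) :
    ∫ x, (∏ i, (f i).eval (x i)) * selbergWeight a b x ∂cubeMeasure N =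
      ∑ σ : Equiv.Perm (Fin N), ∑ τ : Equiv.Perm (Fin N),
      ((Equiv.Perm.sign σ : ℤ) : ℝ) * ((Equiv.Perm.sign τ : ℤ) : ℝ) *
        ∏ i, betaFunctional a b (f i * (jacobi (σ i) a b * jacobi (τ i) a b)) := by
  simp only [prod_eval_mul_selbergWeight_eq_sum ha hb]
  rw [integral_finsetSum _ fun σ _ => integrable_finsetSum _ fun τ _ =>
    (integrable_prod_eval_mul_betaWeight ha hb _).const_mul _]
  refine Finset.sum_congr rfl fun σ _ => ?_
  rw [integral_finsetSum _ fun τ _ =>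
    (integrable_prod_eval_mul_betaWeight ha hb _).const_mul _]
  refine Finset.sum_congr rfl fun τ _ => ?_
  rw [integral_const_mul, integral_fintype_prod_eq_prod
    (f := fun i x => (f i * (jacobi (σ i) a b * jacobi (τ i) a b)).eval x * betaWeight a b x)]
  simp only [integral_eval_mul_betaWeight ha hb]

lemma sum_sign_mul_prod_eq {N : ℕ}
    (F : Equiv.Perm (Fin N) → Equiv.Perm (Fin N) → ℝ)
    (hF : ∀ σ τ, σ ≠ τ → F σ τ = 0) :
    ∑ σ : Equiv.Perm (Fin N), ∑ τ : Equiv.Perm (Fin N),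
      ((Equiv.Perm.sign σ : ℤ) : ℝ) * ((Equiv.Perm.sign τ : ℤ) : ℝ) * F σ τ = ∑ σ, F σ σ := by
  refine Finset.sum_congr rfl fun σ _ => ?_
  rw [Finset.sum_eq_single σ (fun τ _ h => by rw [hF σ τ h.symm, mul_zero]) (by simp)]
  rcases Int.units_eq_one_or (Equiv.Perm.sign σ) with h | h <;> simp [h]

lemma integrable_selbergWeight {N : ℕ} {a b : ℝ} (ha : 0 < a) (hb : 0 < b) :
    Integrable (selbergWeight (N := N) a b) (cubeMeasure N) := by
  simpa using integrable_prod_eval_mul_selbergWeight (N := N) ha hb 1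

lemma integral_selbergWeight_eq_prod_jacobiNorm (N : ℕ) {a b : ℝ} (ha : 0 < a) (hb : 0 < b) :
    ∫ x, selbergWeight a b x ∂cubeMeasure N =
      N.factorial * ∏ k ∈ Finset.range N, jacobiNorm k a b := by
  have h := integral_prod_eval_mul_selbergWeight (N := N) ha hb 1
  simp only [Pi.one_apply, eval_one, Finset.prod_const_one, one_mul] at h
  rw [h, sum_sign_mul_prod_eq]
  · simp only [betaFunctional_jacobi_mul_jacobi ha hb, if_true]
    have (σ : Equiv.Perm (Fin N)) : ∏ i, jacobiNorm (σ i) a b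
        = ∏ k ∈ Finset.range N, jacobiNorm k a b := by
      rw [Equiv.prod_comp σ (fun i : Fin N => jacobiNorm i a b), Finset.prod_range]
    simp [this, Finset.card_univ, Fintype.card_perm]
  · intro σ τ hne
    obtain ⟨i, hi⟩ : ∃ i, σ i ≠ τ i := by
      by_contra! hc; exact hne (Equiv.ext hc)
    refine Finset.prod_eq_zero (Finset.mem_univ i) ?_
    rw [betaFunctional_jacobi_mul_jacobi ha hb, if_neg]
    exact fun h => hi (Fin.ext h)

/-- The Selberg integral at `γ = 1`. -/
lemma integral_selbergWeight (N : ℕ) {a b : ℝ} (ha : 0 < a) (hb : 0 < b) :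
    ∫ x, selbergWeight a b x ∂cubeMeasure N =
      N.factorial * ∏ j ∈ Finset.range N, Real.Gamma (a + j) * Real.Gamma (b + j) * j.factorial /
        Real.Gamma (a + b + N - 1 + j) := by
  rw [integral_selbergWeight_eq_prod_jacobiNorm N ha hb, prod_jacobiNorm N ha hb]

lemma prod_eval_update_X {N : ℕ} (i : Fin N) (x : Fin N → ℝ) :
    ∏ k, (Function.update (1 : Fin N → ℝ[X]) i X k).eval (x k) = x i := by
  rw [Finset.prod_eq_single i (fun k _ hk => by simp [Function.update_of_ne hk]) (by simp)]
  simp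

lemma integrable_coord_mul_selbergWeight {N : ℕ} {a b : ℝ} (ha : 0 < a) (hb : 0 < b) (i : Fin N) :
    Integrable (fun x : Fin N → ℝ => x i * selbergWeight a b x) (cubeMeasure N) := by
  simpa only [prod_eval_update_X] using
    integrable_prod_eval_mul_selbergWeight ha hb (Function.update 1 i X)

lemma integral_coord_mul_selbergWeight {N : ℕ} {a b : ℝ} (ha : 0 < a) (hb : 0 < b) (i : Fin N) :
    ∫ x, x i * selbergWeight a b x ∂cubeMeasure N = ∑ σ : Equiv.Perm (Fin N),
      ((X * jacobi (σ i) a b).coeff (σ i) - (X * jacobi (σ i + 1) a b).coeff (σ i + 1)) *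
        ∏ k ∈ Finset.range N, jacobiNorm k a b := by
  have h := integral_prod_eval_mul_selbergWeight ha hb (Function.update 1 i X)
  simp only [prod_eval_update_X] at h
  rw [h, sum_sign_mul_prod_eq]
  · refine Finset.sum_congr rfl fun σ _ => ?_
    rw [Finset.prod_range, ← Equiv.prod_comp σ (fun i : Fin N => jacobiNorm i a b),
      ← Finset.mul_prod_erase _ _ (Finset.mem_univ i),
      ← Finset.mul_prod_erase _ (fun k => jacobiNorm (σ k) a b) (Finset.mem_univ i),
      Function.update_self, betaFunctional_X_mul_jacobi_sq ha hb, mul_assoc]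
    congr 2
    refine Finset.prod_congr rfl fun k hk => ?_
    rw [Function.update_of_ne (Finset.ne_of_mem_erase hk), Pi.one_apply, one_mul,
      betaFunctional_jacobi_mul_jacobi ha hb, if_pos rfl]
  · intro σ τ hne
    -- Distinct permutations differ in at least two places, hence somewhere away from `i`, where
    -- plain orthogonality applies: if `τ⁻¹ * σ` fixes all other points, injectivity makes it fix
    -- `i`.
    obtain ⟨k, hki, hk⟩ : ∃ k, k ≠ i ∧ σ k ≠ τ k := by
      by_contra! hc
      have hi : ∀ k, k ≠ i → (τ⁻¹ * σ) k = k := fun k hk => by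
        simp [hc k hk]
      refine hne (inv_mul_eq_one.mp (Equiv.ext fun k => ?_)).symm
      by_cases hk : k = i
      · subst hk
        by_contra hne'
        exact hne' ((τ⁻¹ * σ).injective (hi _ hne'))
      · exact hi k hk
    refine Finset.prod_eq_zero (Finset.mem_univ k) ?_
    rw [Function.update_of_ne hki, Pi.one_apply, one_mul,
      betaFunctional_jacobi_mul_jacobi ha hb, if_neg]
    exact fun h => hk (Fin.ext h)

lemma integrable_sum_mul_selbergWeight {N : ℕ} {a b : ℝ} (ha : 0 < a) (hb : 0 < b) :
    Integrable (fun x : Fin N → ℝ => (∑ i, x i) * selbergWeight a b x) (cubeMeasure N) := by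
  simp only [Finset.sum_mul]
  exact integrable_finsetSum _ fun i _ => integrable_coord_mul_selbergWeight ha hb i

/-- The first Aomoto moment of the Selberg density at `γ = 1`. -/
lemma integral_sum_mul_selbergWeight (N : ℕ) {a b : ℝ} (ha : 0 < a) (hb : 0 < b) :
    ∫ x, (∑ i, x i) * selbergWeight a b x ∂cubeMeasure N =
      N * (a + N - 1) / (a + b + 2 * N - 2) * ∫ x, selbergWeight a b x ∂cubeMeasure N := by
  simp only [Finset.sum_mul]
  rw [integral_finsetSum _ fun i _ => integrable_coord_mul_selbergWeight ha hb i,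
    integral_selbergWeight_eq_prod_jacobiNorm N ha hb]
  simp only [integral_coord_mul_selbergWeight ha hb]
  rw [Finset.sum_comm]
  have (σ : Equiv.Perm (Fin N)) : ∑ i, ((X * jacobi (σ i) a b).coeff (σ i) -
      (X * jacobi (σ i + 1) a b).coeff (σ i + 1)) * ∏ k ∈ Finset.range N, jacobiNorm k a b
        = N * (a + N - 1) / (a + b + 2 * N - 2) * ∏ k ∈ Finset.range N, jacobiNorm k a b := by
    have e : ∑ i, ((X * jacobi (σ i) a b).coeff (σ i) -
        (X * jacobi (σ i + 1) a b).coeff (σ i + 1)) = ∑ i ∈ Finset.range N,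
          ((X * jacobi i a b).coeff i - (X * jacobi (i + 1) a b).coeff (i + 1)) := by
      rw [Finset.sum_range]
      exact Equiv.sum_comp σ fun i : Fin N => (X * jacobi (i : ℕ) a b).coeff (i : ℕ) -
        (X * jacobi ((i : ℕ) + 1) a b).coeff ((i : ℕ) + 1)
    -- The recurrence coefficients telescope, leaving minus the subleading coefficient of `jacobi
    -- N`.
    rw [← Finset.sum_mul, e, Finset.sum_range_sub', coeff_jacobi_sub N ha hb]
    simp
  simp only [this]
  simp [Finset.card_univ, Fintype.card_perm]
  ring

/-! ### Uniform power series expansions in `t` -/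

/-- `G t z` is, for `z ∈ S` and `0 ≤ t < 1`, the sum of a power series in `t` whose coefficients are
measurable in `z` and bounded on `S` by those of a power series converging on `[0, 1)`;
the constant term is `1` and the linear coefficient is `d z`. -/
def HasUniformExpansion {Z : Type*} [MeasurableSpace Z] (S : Set Z) (G : ℝ → Z → ℝ)
    (d : Z → ℝ) : Prop :=
  ∃ (g : ℕ → Z → ℝ) (C : ℕ → ℝ), (∀ k, Measurable (g k)) ∧ (∀ k, 0 ≤ C k) ∧
    (∀ k, ∀ z ∈ S, |g k z| ≤ C k) ∧ (∀ t : ℝ, 0 ≤ t → t < 1 → Summable fun k => C k * t ^ k) ∧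
    (∀ t : ℝ, 0 ≤ t → t < 1 → ∀ z ∈ S, HasSum (fun k => g k z * t ^ k) (G t z)) ∧
    (∀ z ∈ S, g 0 z = 1) ∧ ∀ z ∈ S, g 1 z = d z

section UniformExpansion

variable {Z : Type*} [MeasurableSpace Z] {S : Set Z}

lemma HasUniformExpansion.one : HasUniformExpansion S (fun _ _ => 1) fun _ => 0 := by
  refine ⟨fun k _ => if k = 0 then 1 else 0, fun k => if k = 0 then 1 else 0,
    fun k => measurable_const, fun k => by dsimp only; split_ifs <;> simp,
    fun k z _ => by dsimp only; split_ifs <;> simp,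
    fun t _ _ => ?_, fun t _ _ z _ => ?_, fun z _ => by simp, fun z _ => by simp⟩
  · exact summable_of_ne_finset_zero (s := {0}) fun k hk => by
      simp [show k ≠ 0 by simpa using hk]
  · convert hasSum_ite_eq 0 (1 : ℝ) using 2 with k
    split_ifs with h <;> simp [h]

lemma hasSum_cauchyProduct {a b : ℕ → ℝ} {t s u : ℝ} (ha : HasSum (fun k => a k * t ^ k) s)
    (hb : HasSum (fun k => b k * t ^ k) u) :
    HasSum (fun k => (∑ ij ∈ Finset.HasAntidiagonal.antidiagonal k, a ij.1 * b ij.2) * t ^ k) (s * u) := by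
  have e : (fun k => (∑ ij ∈ Finset.HasAntidiagonal.antidiagonal k, a ij.1 * b ij.2) * t ^ k) =
      fun k => ∑ ij ∈ Finset.HasAntidiagonal.antidiagonal k, (a ij.1 * t ^ ij.1) * (b ij.2 * t ^ ij.2) := by
    funext k
    rw [Finset.sum_mul]
    refine Finset.sum_congr rfl fun ij hij => ?_
    rw [← Finset.HasAntidiagonal.mem_antidiagonal.mp hij, pow_add]
    ring
  have ha' := ha.summable.norm
  have hb' := hb.summable.norm
  rw [e, ← ha.tsum_eq, ← hb.tsum_eq, tsum_mul_tsum_eq_tsum_sum_antidiagonal_of_summable_norm ha' hb']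
  exact (summable_norm_sum_mul_antidiagonal_of_summable_norm ha' hb').of_norm.hasSum

/-- Cauchy products preserve the uniform bounds; since both constant terms are `1`, the linear
coefficients add. -/
lemma HasUniformExpansion.mul {G H : ℝ → Z → ℝ} {d e : Z → ℝ} (hG : HasUniformExpansion S G d)
    (hH : HasUniformExpansion S H e) :
    HasUniformExpansion S (fun t z => G t z * H t z) fun z => d z + e z := by
  obtain ⟨g, C, hg, hC, hgC, hCs, hsum, h0, h1⟩ := hG
  obtain ⟨g', C', hg', hC', hgC', hCs', hsum', h0', h1'⟩ := hH
  refine ⟨fun k z => ∑ ij ∈ Finset.HasAntidiagonal.antidiagonal k, g ij.1 z * g' ij.2 z,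
    fun k => ∑ ij ∈ Finset.HasAntidiagonal.antidiagonal k, C ij.1 * C' ij.2, fun k => ?_, fun k => ?_,
    fun k z hz => ?_, fun t ht ht1 => ?_, fun t ht ht1 z hz => ?_, fun z hz => ?_, fun z hz => ?_⟩
  · exact Finset.measurable_sum _ fun ij _ => (hg _).mul (hg' _)
  · exact Finset.sum_nonneg fun ij _ => mul_nonneg (hC _) (hC' _)
  · refine (Finset.abs_sum_le_sum_abs _ _).trans (Finset.sum_le_sum fun ij _ => ?_)
    rw [abs_mul]
    exact mul_le_mul (hgC _ z hz) (hgC' _ z hz) (abs_nonneg _) (hC _)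
  · have := hasSum_cauchyProduct (a := C) (b := C') (hCs t ht ht1).hasSum (hCs' t ht ht1).hasSum
    exact this.summable
  · have := hasSum_cauchyProduct (a := (g · z)) (b := (g' · z)) (hsum t ht ht1 z hz)
      (hsum' t ht ht1 z hz)
    exact this
  · simp [h0 z hz, h0' z hz]
  · simp [Finset.Nat.antidiagonal_succ, h0 z hz, h0' z hz, h1 z hz, h1' z hz, add_comm]

lemma HasUniformExpansion.prod {ι : Type*} (s : Finset ι) {G : ι → ℝ → Z → ℝ} {d : ι → Z → ℝ}
    (h : ∀ i, HasUniformExpansion S (G i) (d i)) :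
    HasUniformExpansion S (fun t z => ∏ i ∈ s, G i t z) fun z => ∑ i ∈ s, d i z := by
  classical
  induction s using Finset.induction_on with
  | empty => simpa using HasUniformExpansion.one
  | insert i s hi ih => simpa [Finset.prod_insert hi, Finset.sum_insert hi] using (h i).mul ih

/-- The binomial series as a uniform expansion. -/
lemma HasUniformExpansion.one_sub_rpow_inv (a : ℝ) {y : Z → ℝ} (hy : Measurable y)
    (hyS : ∀ z ∈ S, y z ∈ Set.Ioo (0 : ℝ) 1) :
    HasUniformExpansion S (fun t z => ((1 - t * y z) ^ a)⁻¹) fun z => a * y z := by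
  have key : ∀ x : ℝ, |x| < 1 →
      HasSum (fun k : ℕ => Ring.choose (a + k - 1) k * x ^ k) ((1 - x) ^ a)⁻¹ := fun x hx => by
    have h := (Real.one_div_one_sub_rpow_hasFPowerSeriesOnBall_zero a).hasSum (y := x)
      (by simpa [enorm_eq_nnnorm] using! hx)
    simpa [mul_comm] using h
  -- As `0 < y < 1`, dropping `y ^ k` bounds the coefficients; the bounding series converges because
  -- real summability is absolute.
  refine ⟨fun k z => Ring.choose (a + k - 1) k * y z ^ k, fun k => |Ring.choose (a + k - 1) k|,
    fun k => by fun_prop, fun k => abs_nonneg _, fun k z hz => ?_, fun t ht ht1 => ?_,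
    fun t ht ht1 z hz => ?_, fun z hz => by simp, fun z hz => by simp⟩
  · rw [abs_mul]
    refine mul_le_of_le_one_right (abs_nonneg _) ?_
    rw [abs_pow, abs_of_pos (hyS z hz).1]
    exact pow_le_one₀ (hyS z hz).1.le (hyS z hz).2.le
  · simpa [abs_mul, abs_of_nonneg ht] using (key t (by rwa [abs_of_nonneg ht])).summable.abs
  · have h0 := (hyS z hz).1.le
    have := key (t * y z) (by
      rw [abs_of_nonneg (by positivity)]
      nlinarith [(hyS z hz).2])
    simpa [mul_pow, mul_comm, mul_left_comm, mul_assoc] using this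

/-- Integrating a uniform expansion term by term against an integrable weight. -/
lemma HasUniformExpansion.exists_hasSum_integral {G : ℝ → Z → ℝ} {d : Z → ℝ}
    (hG : HasUniformExpansion S G d) {μ : Measure Z} (hS : ∀ᵐ z ∂μ, z ∈ S) {W : Z → ℝ}
    (hW : Integrable W μ) :
    ∃ c : ℕ → ℝ, (∀ t : ℝ, 0 ≤ t → t < 1 → Integrable (fun z => W z * G t z) μ ∧
      HasSum (fun k => c k * t ^ k) (∫ z, W z * G t z ∂μ)) ∧
      c 0 = ∫ z, W z ∂μ ∧ c 1 = ∫ z, W z * d z ∂μ := by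
  obtain ⟨g, C, hg, hC, hgC, hCs, hsum, h0, h1⟩ := hG
  have hint : ∀ k, Integrable (fun z => W z * g k z) μ := fun k =>
    hW.mul_bdd (c := C k) (hg k).aestronglyMeasurable (hS.mono fun z hz => hgC k z hz)
  refine ⟨fun k => ∫ z, W z * g k z ∂μ, fun t ht ht1 => ?_, ?_, ?_⟩
  · have hF : ∀ k, Integrable (fun z => W z * g k z * t ^ k) μ := fun k => (hint k).mul_const _
    have hb : ∀ᵐ z ∂μ, ∀ k, ‖W z * g k z * t ^ k‖ ≤ ‖W z‖ * (C k * t ^ k) := by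
      filter_upwards [hS] with z hz k
      rw [norm_mul, norm_mul, mul_assoc, norm_pow, Real.norm_of_nonneg ht]
      exact mul_le_mul_of_nonneg_left (mul_le_mul_of_nonneg_right (hgC k z hz) (by positivity))
        (norm_nonneg _)
    have hlim : ∀ᵐ z ∂μ, HasSum (fun k => W z * g k z * t ^ k) (W z * G t z) := by
      filter_upwards [hS] with z hz
      simpa [mul_assoc] using (hsum t ht ht1 z hz).mul_left (W z)
    have hs := hCs t ht ht1
    -- `G t` is not assumed measurable; it is so almost everywhere as a limit of partial sums.
    have hmeas : AEStronglyMeasurable (fun z => W z * G t z) μ := by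
      refine aestronglyMeasurable_of_tendsto_ae Filter.atTop (f := fun n z =>
        ∑ k ∈ Finset.range n, W z * g k z * t ^ k) (fun n => ?_)
        (hlim.mono fun z hz => hz.tendsto_sum_nat)
      exact (integrable_finsetSum _ fun k _ => hF k).aestronglyMeasurable
    constructor
    · refine (hW.norm.mul_const (∑' k, C k * t ^ k)).mono' hmeas ?_
      filter_upwards [hb, hlim] with z hz hz'
      rw [← hz'.tsum_eq, ← tsum_mul_left]
      exact tsum_of_norm_bounded (hs.mul_left _).hasSum hz
    · have := hasSum_integral_of_dominated_convergence (μ := μ)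
        (F := fun k z => W z * g k z * t ^ k) (f := fun z => W z * G t z)
        (fun k z => ‖W z‖ * (C k * t ^ k)) (fun k => (hF k).aestronglyMeasurable)
        (fun k => hb.mono fun z hz => hz k) (Filter.Eventually.of_forall fun z => hs.mul_left _)
        (by simpa only [tsum_mul_left] using hW.norm.mul_const _) hlim
      simpa only [integral_mul_const] using this
  · exact integral_congr_ae (hS.mono fun z hz => by simp [h0 z hz])
  · exact integral_congr_ae (hS.mono fun z hz => by simp [h1 z hz])

end UniformExpansion

/-! ### Two coupled Selberg densities -/

lemma volume_restrict_unitCube_prod (N M : ℕ) :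
    (volume : Measure ((Fin N → ℝ) × (Fin M → ℝ))).restrict (unitCube N ×ˢ unitCube M) =
      (cubeMeasure N).prod (cubeMeasure M) := by
  rw [Measure.volume_eq_prod, ← Measure.prod_restrict, unitCube, unitCube, volume_pi, volume_pi,
    Measure.restrict_pi_pi, Measure.restrict_pi_pi]

lemma measurableSet_unitCube (N : ℕ) : MeasurableSet (unitCube N) :=
  MeasurableSet.univ_pi fun _ => measurableSet_Ioo

/-- The common shape of the form factor integrands: Selberg densities in two groups of variables,
times an interaction that equals `1` at `t = 0`. -/
noncomputable def coupledIntegrand {N M : ℕ} (a b a' b' t : ℝ) (z : (Fin N → ℝ) × (Fin M → ℝ)) :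
    ℝ :=
  (selbergWeight a b z.1 * selbergWeight a' b' z.2) *
    ((∏ j, ((1 - t * z.1 j) ^ (1 / 2 : ℝ))⁻¹) * (∏ j, ((1 - t * z.2 j) ^ (-(1 / 2) : ℝ))⁻¹) *
      ∏ j, ∏ k, ((1 - t * (z.1 j * z.2 k)) ^ (2 : ℝ))⁻¹)

lemma hasUniformExpansion_interaction (N M : ℕ) :
    HasUniformExpansion (unitCube N ×ˢ unitCube M)
      (fun t z => (∏ j, ((1 - t * z.1 j) ^ (1 / 2 : ℝ))⁻¹) *
        (∏ j, ((1 - t * z.2 j) ^ (-(1 / 2) : ℝ))⁻¹) *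
        ∏ j, ∏ k, ((1 - t * (z.1 j * z.2 k)) ^ (2 : ℝ))⁻¹)
      fun z => (∑ j, 1 / 2 * z.1 j) + (∑ j, -(1 / 2) * z.2 j) +
        ∑ j, ∑ k, 2 * (z.1 j * z.2 k) := by
  have hu : ∀ j, HasUniformExpansion (unitCube N ×ˢ unitCube M)
      (fun t z => ((1 - t * z.1 j) ^ (1 / 2 : ℝ))⁻¹) (fun z => 1 / 2 * z.1 j) := fun j =>
    .one_sub_rpow_inv _ (by fun_prop) fun z hz => hz.1 j trivial
  have hv : ∀ j, HasUniformExpansion (unitCube N ×ˢ unitCube M)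
      (fun t z => ((1 - t * z.2 j) ^ (-(1 / 2) : ℝ))⁻¹) (fun z => -(1 / 2) * z.2 j) := fun j =>
    .one_sub_rpow_inv _ (by fun_prop) fun z hz => hz.2 j trivial
  have huv : ∀ j k, HasUniformExpansion (unitCube N ×ˢ unitCube M)
      (fun t z => ((1 - t * (z.1 j * z.2 k)) ^ (2 : ℝ))⁻¹) (fun z => 2 * (z.1 j * z.2 k)) :=
    fun j k => .one_sub_rpow_inv _ (by fun_prop) fun z hz => by
      have h1 : z.1 j ∈ Set.Ioo (0 : ℝ) 1 := hz.1 j trivial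
      have h2 : z.2 k ∈ Set.Ioo (0 : ℝ) 1 := hz.2 k trivial
      exact ⟨mul_pos h1.1 h2.1, mul_lt_one_of_nonneg_of_lt_one_left h1.1.le h1.2 h2.2.le⟩
  exact ((HasUniformExpansion.prod _ hu).mul (.prod _ hv)).mul (.prod _ fun j => .prod _ (huv j))

/-- The numbers `e` and `e'` are the Aomoto means of the two groups, passed through equations so
that they can be supplied in simplified form. -/
lemma exists_hasSum_integral_coupledIntegrand (N M : ℕ) {a b a' b' : ℝ} (ha : 0 < a) (hb : 0 < b)
    (ha' : 0 < a') (hb' : 0 < b') {e e' : ℝ} (he : N * (a + N - 1) / (a + b + 2 * N - 2) = e)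
    (he' : M * (a' + M - 1) / (a' + b' + 2 * M - 2) = e') :
    ∃ c : ℕ → ℝ, (∀ t : ℝ, 0 ≤ t → t < 1 →
      IntegrableOn (coupledIntegrand a b a' b' t) (unitCube N ×ˢ unitCube M) ∧
      HasSum (fun k => c k * t ^ k)
        (∫ z in unitCube N ×ˢ unitCube M, coupledIntegrand a b a' b' t z)) ∧
      c 0 = (N.factorial * ∏ j ∈ Finset.range N, Real.Gamma (a + j) * Real.Gamma (b + j) *
          j.factorial / Real.Gamma (a + b + N - 1 + j)) *
        (M.factorial * ∏ j ∈ Finset.range M, Real.Gamma (a' + j) * Real.Gamma (b' + j) *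
          j.factorial / Real.Gamma (a' + b' + M - 1 + j)) ∧
      c 1 = c 0 * (e / 2 - e' / 2 + 2 * e * e') := by
  have hS : ∀ᵐ z ∂volume.restrict (unitCube N ×ˢ unitCube M), z ∈ unitCube N ×ˢ unitCube M :=
    ae_restrict_mem ((measurableSet_unitCube N).prod (measurableSet_unitCube M))
  rw [volume_restrict_unitCube_prod] at hS
  have hu := integrable_selbergWeight (N := N) ha hb
  have hv := integrable_selbergWeight (N := M) ha' hb'
  have hu1 := integrable_sum_mul_selbergWeight (N := N) ha hb
  have hv1 := integrable_sum_mul_selbergWeight (N := M) ha' hb'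
  obtain ⟨c, hc, h0, h1⟩ := (hasUniformExpansion_interaction N M).exists_hasSum_integral hS
    (hu.mul_prod hv)
  have e0 : c 0 = (∫ x, selbergWeight a b x ∂cubeMeasure N) *
      ∫ x, selbergWeight a' b' x ∂cubeMeasure M := by rw [h0, integral_prod_mul]
  refine ⟨c, fun t ht ht1 => ?_, ?_, ?_⟩
  · simp only [IntegrableOn, volume_restrict_unitCube_prod]
    exact hc t ht ht1
  · rw [e0, integral_selbergWeight N ha hb, integral_selbergWeight M ha' hb']
  · have e1 : ∀ z : (Fin N → ℝ) × (Fin M → ℝ), selbergWeight a b z.1 * selbergWeight a' b' z.2 *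
        ((∑ j, 1 / 2 * z.1 j) + (∑ j, -(1 / 2) * z.2 j) + ∑ j, ∑ k, 2 * (z.1 j * z.2 k)) =
        1 / 2 * (((∑ j, z.1 j) * selbergWeight a b z.1) * selbergWeight a' b' z.2) -
        1 / 2 * (selbergWeight a b z.1 * ((∑ j, z.2 j) * selbergWeight a' b' z.2)) +
        2 * (((∑ j, z.1 j) * selbergWeight a b z.1) *
          ((∑ j, z.2 j) * selbergWeight a' b' z.2)) := fun z => by
      simp only [← Finset.mul_sum, ← Finset.sum_mul]
      ring
    rw [h1]
    simp only [e1]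
    rw [integral_add, integral_sub, integral_const_mul, integral_const_mul, integral_const_mul,
      integral_prod_mul (fun x : Fin N → ℝ => (∑ j, x j) * selbergWeight a b x)
        (selbergWeight a' b'),
      integral_prod_mul (selbergWeight a b)
        (fun x : Fin M → ℝ => (∑ j, x j) * selbergWeight a' b' x),
      integral_prod_mul (fun x : Fin N → ℝ => (∑ j, x j) * selbergWeight a b x)
        (fun x : Fin M → ℝ => (∑ j, x j) * selbergWeight a' b' x),
      integral_sum_mul_selbergWeight N ha hb, integral_sum_mul_selbergWeight M ha' hb', he, he', e0]
    · ring
    · exact (hu1.mul_prod hv).const_mul _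
    · exact (hu.mul_prod hv1).const_mul _
    · exact ((hu1.mul_prod hv).const_mul _).sub ((hu.mul_prod hv1).const_mul _)
    · exact (hu1.mul_prod hv1).const_mul _

/-! ### Form factor integrands as coupled densities -/

lemma pow_mul_inv_sub_one_rpow {x : ℝ} (hx : x ∈ Set.Ioo (0 : ℝ) 1) (n : ℕ) (c : ℝ) :
    x ^ n * (x⁻¹ - 1) ^ c = betaWeight (n + 1 - c) (c + 1) x := by
  have h1 : 0 ≤ 1 - x := by linarith [hx.2]
  have e : x⁻¹ - 1 = (1 - x) / x := by have := hx.1.ne'; field_simp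
  rw [betaWeight, e, Real.div_rpow h1 hx.1.le, show (n : ℝ) + 1 - c - 1 = n - c by ring,
    Real.rpow_sub hx.1, Real.rpow_natCast, add_sub_cancel_right]
  ring

lemma lowIntegrand_eq_coupledIntegrand (n p : ℕ) {t : ℝ} (ht : 0 ≤ t) (ht1 : t < 1)
    {z : (Fin p → ℝ) × (Fin p → ℝ)} (hz : z ∈ unitCube p ×ˢ unitCube p) :
    lowIntegrand n p t z = coupledIntegrand (n + 3 / 2) (1 / 2) (n + 1 / 2) (3 / 2) t z := by
  have h1 : ∀ j, z.1 j ^ n * z.2 j ^ n * (((1 - t * z.2 j) * ((z.2 j)⁻¹ - 1)) /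
      ((1 - t * z.1 j) * ((z.1 j)⁻¹ - 1))) ^ (1 / 2 : ℝ) =
      betaWeight (n + 3 / 2) (1 / 2) (z.1 j) * betaWeight (n + 1 / 2) (3 / 2) (z.2 j) *
        (((1 - t * z.1 j) ^ (1 / 2 : ℝ))⁻¹ * ((1 - t * z.2 j) ^ (-(1 / 2) : ℝ))⁻¹) := fun j => by
    have hu : z.1 j ∈ Set.Ioo (0 : ℝ) 1 := hz.1 j trivial
    have hv : z.2 j ∈ Set.Ioo (0 : ℝ) 1 := hz.2 j trivial
    have eu := pow_mul_inv_sub_one_rpow hu n (-(1 / 2))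
    have ev := pow_mul_inv_sub_one_rpow hv n (1 / 2)
    have hu1 : 0 ≤ (z.1 j)⁻¹ - 1 := sub_nonneg.mpr ((one_le_inv₀ hu.1).mpr hu.2.le)
    have hv1 : 0 ≤ (z.2 j)⁻¹ - 1 := sub_nonneg.mpr ((one_le_inv₀ hv.1).mpr hv.2.le)
    have hu2 : 0 ≤ 1 - t * z.1 j := by nlinarith [hu.1, hu.2]
    have hv2 : 0 ≤ 1 - t * z.2 j := by nlinarith [hv.1, hv.2]
    rw [show (n : ℝ) + 1 - -(1 / 2) = n + 3 / 2 by ring,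
      show -(1 / 2) + 1 = (1 / 2 : ℝ) by norm_num, Real.rpow_neg hu1] at eu
    rw [show (n : ℝ) + 1 - 1 / 2 = n + 1 / 2 by ring,
      show 1 / 2 + 1 = (3 / 2 : ℝ) by norm_num] at ev
    rw [← eu, ← ev, Real.div_rpow (mul_nonneg hv2 hv1) (mul_nonneg hu2 hu1),
      Real.mul_rpow hv2 hv1, Real.mul_rpow hu2 hu1, Real.rpow_neg hv2, inv_inv, div_eq_mul_inv,
      mul_inv]
    ring
  have h2 : ∏ j, ∏ k, ((1 - t * z.1 k * z.2 j) ^ 2)⁻¹ =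
      ∏ j, ∏ k, ((1 - t * (z.1 j * z.2 k)) ^ (2 : ℝ))⁻¹ := by
    rw [Finset.prod_comm]
    refine Finset.prod_congr rfl fun j _ => Finset.prod_congr rfl fun k _ => ?_
    rw [Real.rpow_two, mul_assoc]
  rw [lowIntegrand, h2, ← Finset.prod_mul_distrib, ← Finset.prod_mul_distrib]
  simp only [h1, Finset.prod_mul_distrib, coupledIntegrand, selbergWeight, vandermondeSq]
  ring

lemma highIntegrand_eq_coupledIntegrand (n p : ℕ) {t : ℝ} (ht : 0 ≤ t) (ht1 : t < 1)
    {z : (Fin (p + 1) → ℝ) × (Fin p → ℝ)} (hz : z ∈ unitCube (p + 1) ×ˢ unitCube p) :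
    highIntegrand n p t z = coupledIntegrand (n + 1 / 2) (1 / 2) (n + 3 / 2) (3 / 2) t z := by
  have h1 : ∀ j, z.1 j ^ n * ((z.1 j)⁻¹ * (1 - t * z.1 j) ^ (-(1 / 2) : ℝ) *
      ((z.1 j)⁻¹ - 1) ^ (-(1 / 2) : ℝ)) =
      betaWeight (n + 1 / 2) (1 / 2) (z.1 j) * ((1 - t * z.1 j) ^ (1 / 2 : ℝ))⁻¹ := fun j => by
    have hu : z.1 j ∈ Set.Ioo (0 : ℝ) 1 := hz.1 j trivial
    have eu := pow_mul_inv_sub_one_rpow hu n (-(1 / 2))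
    have hu2 : 0 ≤ 1 - t * z.1 j := by nlinarith [hu.1, hu.2]
    -- The extra factor `u⁻¹` lowers the first beta parameter from `n + 3/2` to `n + 1/2`.
    have e1 := betaWeight_mul_pow (a := n + 1 / 2) (b := 1 / 2) hu.1 1
    rw [show (n : ℝ) + 1 - -(1 / 2) = n + 1 / 2 + (1 : ℕ) by push_cast; ring,
      show -(1 / 2) + 1 = (1 / 2 : ℝ) by norm_num, ← e1, pow_one] at eu
    rw [Real.rpow_neg hu2]
    have := hu.1.ne'
    calc _ = (z.1 j)⁻¹ * (z.1 j ^ n * ((z.1 j)⁻¹ - 1) ^ (-(1 / 2) : ℝ)) *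
          ((1 - t * z.1 j) ^ (1 / 2 : ℝ))⁻¹ := by ring
      _ = _ := by rw [eu, inv_mul_cancel_left₀ this]
  have h2 : ∀ j, z.2 j ^ n * (z.2 j * (1 - t * z.2 j) ^ (1 / 2 : ℝ) *
      ((z.2 j)⁻¹ - 1) ^ (1 / 2 : ℝ)) =
      betaWeight (n + 3 / 2) (3 / 2) (z.2 j) * ((1 - t * z.2 j) ^ (-(1 / 2) : ℝ))⁻¹ := fun j => by
    have hv : z.2 j ∈ Set.Ioo (0 : ℝ) 1 := hz.2 j trivial
    -- The power is `n + 1` because the integrand has an extra factor `v`.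
    have ev := pow_mul_inv_sub_one_rpow hv (n + 1) (1 / 2)
    have hv2 : 0 ≤ 1 - t * z.2 j := by nlinarith [hv.1, hv.2]
    rw [show ((n + 1 : ℕ) : ℝ) + 1 - 1 / 2 = n + 3 / 2 by push_cast; ring,
      show 1 / 2 + 1 = (3 / 2 : ℝ) by norm_num] at ev
    rw [← ev, Real.rpow_neg hv2, inv_inv]
    ring
  have h3 : ∏ j, ∏ k, ((1 - t * z.1 j * z.2 k) ^ 2)⁻¹ =
      ∏ j, ∏ k, ((1 - t * (z.1 j * z.2 k)) ^ (2 : ℝ))⁻¹ := by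
    refine Finset.prod_congr rfl fun j _ => Finset.prod_congr rfl fun k _ => ?_
    rw [Real.rpow_two, mul_assoc]
  have h1' := Finset.prod_congr rfl (fun j (_ : j ∈ Finset.univ) => h1 j)
  have h2' := Finset.prod_congr rfl (fun j (_ : j ∈ Finset.univ) => h2 j)
  simp only [Finset.prod_mul_distrib] at h1' h2'
  rw [highIntegrand, h3, coupledIntegrand, selbergWeight, selbergWeight, vandermondeSq,
    vandermondeSq]
  generalize (∏ j, ∏ k, ((1 - t * (z.1 j * z.2 k)) ^ (2 : ℝ))⁻¹) = A
  generalize (∏ i, ∏ j ∈ Finset.Ioi i, (z.1 i - z.1 j) ^ 2) = B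
  generalize (∏ i, ∏ j ∈ Finset.Ioi i, (z.2 i - z.2 j) ^ 2) = D
  simp only [Finset.prod_mul_distrib]
  linear_combination A * B * D * (((∏ j, z.2 j ^ n) * ((∏ j, z.2 j) *
    (∏ j, (1 - t * z.2 j) ^ (1 / 2 : ℝ)) * ∏ j, ((z.2 j)⁻¹ - 1) ^ (1 / 2 : ℝ))) * h1' +
    ((∏ j, betaWeight (n + 1 / 2) (1 / 2) (z.1 j)) *
      ∏ j, ((1 - t * z.1 j) ^ (1 / 2 : ℝ))⁻¹) * h2')

/-! ### Gamma products in the leading coefficients -/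

lemma prod_Gamma_shift (x : ℝ) (p : ℕ) :
    (∏ j ∈ Finset.range p, Real.Gamma (x + 1 + j)) * Real.Gamma x =
      (∏ j ∈ Finset.range p, Real.Gamma (x + j)) * Real.Gamma (x + p) := by
  rw [← Finset.prod_range_succ (fun j : ℕ => Real.Gamma (x + j)), Finset.prod_range_succ']
  simp [add_assoc, add_comm (1 : ℝ)]

lemma prod_Gamma_add_two (p : ℕ) :
    ∏ j ∈ Finset.range p, Real.Gamma ((j : ℝ) + 2) =
      p.factorial * ∏ j ∈ Finset.range p, (j.factorial : ℝ) := by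
  rw [← Finset.prod_range_add_one_eq_factorial, Nat.cast_prod, ← Finset.prod_mul_distrib]
  refine Finset.prod_congr rfl fun j _ => ?_
  rw [show (j : ℝ) + 2 = (j + 1 : ℕ) + 1 by push_cast; ring, Real.Gamma_nat_eq_factorial,
    Nat.factorial_succ, Nat.cast_mul]

/-- The two groups have the parameters `n + 1/2` and `1/2` shifted by one in opposite roles.
`prod_Gamma_shift` aligns them into a square, at the cost of the unsquared boundary ratio. -/
lemma selberg_product_low (n p : ℕ) :
    (p.factorial * ∏ j ∈ Finset.range p, Real.Gamma ((n : ℝ) + 3 / 2 + j) *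
        Real.Gamma (1 / 2 + j) * j.factorial / Real.Gamma ((n : ℝ) + 3 / 2 + 1 / 2 + p - 1 + j)) *
      (p.factorial * ∏ j ∈ Finset.range p, Real.Gamma ((n : ℝ) + 1 / 2 + j) *
        Real.Gamma (3 / 2 + j) * j.factorial / Real.Gamma ((n : ℝ) + 1 / 2 + 3 / 2 + p - 1 + j)) =
    (Real.Gamma (n + p + 1 / 2) * Real.Gamma (p + 1 / 2) /
        (Real.Gamma (n + 1 / 2) * Real.Gamma (1 / 2))) *
      (∏ j ∈ Finset.range p, Real.Gamma (n + j + 1 / 2) * Real.Gamma (j + 1 / 2) *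
        Real.Gamma (j + 2) / Real.Gamma (n + p + j + 1)) ^ 2 := by
  have g1 : Real.Gamma ((n : ℝ) + 1 / 2) ≠ 0 := (Real.Gamma_pos_of_pos (by positivity)).ne'
  have g2 : Real.Gamma (1 / 2) ≠ 0 := (Real.Gamma_pos_of_pos (by positivity)).ne'
  have s1 := prod_Gamma_shift ((n : ℝ) + 1 / 2) p
  have s2 := prod_Gamma_shift (1 / 2) p
  have r1 : ∀ j : ℕ, (n : ℝ) + 3 / 2 + 1 / 2 + p - 1 + j = n + p + j + 1 := fun j => by ring
  have r2 : ∀ j : ℕ, (n : ℝ) + 1 / 2 + 3 / 2 + p - 1 + j = n + p + j + 1 := fun j => by ring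
  have r3 : ∀ j : ℕ, Real.Gamma ((n : ℝ) + j + 1 / 2) = Real.Gamma ((n : ℝ) + 1 / 2 + j) :=
    fun j => by congr 1; ring
  have r4 : ∀ j : ℕ, Real.Gamma ((j : ℝ) + 1 / 2) = Real.Gamma (1 / 2 + j) :=
    fun j => by rw [add_comm]
  rw [show (n : ℝ) + 1 / 2 + 1 = n + 3 / 2 by ring, ← eq_div_iff g1] at s1
  rw [show (1 / 2 : ℝ) + 1 = 3 / 2 by norm_num, ← eq_div_iff g2] at s2
  simp only [Finset.prod_div_distrib, Finset.prod_mul_distrib, r1, r2, r3, r4, s1, s2,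
    prod_Gamma_add_two]
  ring

/-- Removing the `j = 0` factor from the larger group leaves the Gamma factors of the smaller one;
that factor is the unsquared term. -/
lemma selberg_product_high (n p : ℕ) :
    ((p + 1).factorial * ∏ j ∈ Finset.range (p + 1), Real.Gamma ((n : ℝ) + 1 / 2 + j) *
        Real.Gamma (1 / 2 + j) * j.factorial /
          Real.Gamma ((n : ℝ) + 1 / 2 + 1 / 2 + (p + 1 : ℕ) - 1 + j)) *
      (p.factorial * ∏ j ∈ Finset.range p, Real.Gamma ((n : ℝ) + 3 / 2 + j) *
        Real.Gamma (3 / 2 + j) * j.factorial / Real.Gamma ((n : ℝ) + 3 / 2 + 3 / 2 + p - 1 + j)) =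
    (p + 1).factorial * ((Real.Gamma (n + 1 / 2) * Real.Gamma (1 / 2) / Real.Gamma (n + p + 1)) *
      (∏ j ∈ Finset.range p, Real.Gamma (n + j + 3 / 2) * Real.Gamma (j + 3 / 2) *
        Real.Gamma (j + 2) / Real.Gamma (n + p + j + 2)) ^ 2) := by
  have r1 : ∀ j : ℕ, (n : ℝ) + 1 / 2 + (j + 1 : ℕ) = n + 3 / 2 + j := fun j => by push_cast; ring
  have r2 : ∀ j : ℕ, (1 / 2 : ℝ) + (j + 1 : ℕ) = 3 / 2 + j := fun j => by push_cast; ring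
  have r3 : ∀ j : ℕ, (n : ℝ) + p + 1 + (j + 1 : ℕ) = n + p + j + 2 :=
    fun j => by push_cast; ring
  have r4 : ∀ j : ℕ, (n : ℝ) + 3 / 2 + 3 / 2 + p - 1 + j = n + p + j + 2 := fun j => by ring
  have r5 : ∀ j : ℕ, Real.Gamma ((n : ℝ) + j + 3 / 2) = Real.Gamma ((n : ℝ) + 3 / 2 + j) :=
    fun j => by congr 1; ring
  have r6 : ∀ j : ℕ, Real.Gamma ((j : ℝ) + 3 / 2) = Real.Gamma (3 / 2 + j) :=
    fun j => by rw [add_comm]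
  have r7 : (n : ℝ) + 1 / 2 + 1 / 2 + (p + 1 : ℕ) - 1 = n + p + 1 := by push_cast; ring
  have r8 : ∀ j : ℕ, ((j + 1).factorial : ℝ) = Real.Gamma ((j : ℝ) + 2) := fun j => by
    rw [← Real.Gamma_nat_eq_factorial]; congr 1; push_cast; ring
  rw [Finset.prod_range_succ']
  simp only [r1, r2, r3, r4, r5, r6, r7, r8, Finset.prod_div_distrib, Finset.prod_mul_distrib,
    prod_Gamma_add_two, Nat.cast_zero, add_zero, Nat.factorial_zero, Nat.cast_one, mul_one]
  ring

/-! ### Expansions of the form factors -/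

lemma lowFormFactor_expansion (n : ℕ) :
    ∀ p : ℕ, 1 ≤ p →
      (∀ t : ℝ, 0 ≤ t → t < 1 →
        IntegrableOn (lowIntegrand n p t)
          (unitCube p ×ˢ unitCube p)) ∧
      ∃ c : ℕ → ℝ,
        (∀ t : ℝ, 0 ≤ t → t < 1 → ∃ s : ℝ, HasSum (fun k : ℕ => c k * t ^ k) s ∧
          lowFormFactor n p t = t ^ (p * (n + p)) * s) ∧
        c 0 = 1 / ((p.factorial : ℝ) ^ 2 * Real.pi ^ (2 * p)) *
          (Real.Gamma (n + p + 1 / 2) * Real.Gamma (p + 1 / 2) /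
            (Real.Gamma (n + 1 / 2) * Real.Gamma (1 / 2))) *
          (∏ j ∈ Finset.range p,
            Real.Gamma (n + j + 1 / 2) * Real.Gamma (j + 1 / 2) * Real.Gamma (j + 2) /
              Real.Gamma (n + p + j + 1)) ^ 2 ∧
        c 1 = c 0 * ((p : ℝ) * (n + p) / (2 * ((n : ℝ) + 2 * p) ^ 2)) *
          (4 * p * (n + p) + 1) := by
  intro p hp
  have hm : MeasurableSet (unitCube p ×ˢ unitCube p) :=
    (measurableSet_unitCube p).prod (measurableSet_unitCube p)
  have hp0 : (0 : ℝ) < p := by exact_mod_cast hp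
  have hd : (n : ℝ) + 2 * p ≠ 0 := by positivity
  obtain ⟨c, hc, h0, h1⟩ := exists_hasSum_integral_coupledIntegrand p p
    (a := n + 3 / 2) (b := 1 / 2) (a' := n + 1 / 2) (b' := 3 / 2)
    (by positivity) (by positivity) (by positivity) (by positivity)
    (e := p * (n + p + 1 / 2) / (n + 2 * p)) (e' := p * (n + p - 1 / 2) / (n + 2 * p))
    (by congr 1 <;> ring) (by congr 1 <;> ring)
  have heq : ∀ t : ℝ, 0 ≤ t → t < 1 → Set.EqOn (lowIntegrand n p t)
      (coupledIntegrand (n + 3 / 2) (1 / 2) (n + 1 / 2) (3 / 2) t)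
      (unitCube p ×ˢ unitCube p) := fun t ht ht1 z hz =>
    lowIntegrand_eq_coupledIntegrand n p ht ht1 hz
  refine ⟨fun t ht ht1 => (hc t ht ht1).1.congr_fun (heq t ht ht1).symm hm,
    fun k => 1 / ((p.factorial : ℝ) ^ 2 * Real.pi ^ (2 * p)) * c k, fun t ht ht1 => ?_, ?_, ?_⟩
  · have hs := (hc t ht ht1).2.mul_left
      (1 / ((p.factorial : ℝ) ^ 2 * Real.pi ^ (2 * p)))
    simp only [← mul_assoc] at hs
    refine ⟨_, hs, ?_⟩
    rw [lowFormFactor, setIntegral_congr_fun hm (heq t ht ht1)]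
    ring
  · dsimp only
    rw [h0, selberg_product_low]
    ring
  · dsimp only
    rw [h1]
    field_simp
    ring

lemma highFormFactor_expansion (n : ℕ) :
    ∀ p : ℕ,
      (∀ t : ℝ, 0 ≤ t → t < 1 →
        IntegrableOn (highIntegrand n p t)
          (unitCube (p + 1) ×ˢ unitCube p)) ∧
      ∃ c : ℕ → ℝ,
        (∀ t : ℝ, 0 ≤ t → t < 1 → ∃ s : ℝ, HasSum (fun k : ℕ => c k * t ^ k) s ∧
          highFormFactor n p t =
            t ^ ((n : ℝ) * (p + 1 / 2) + p * (p + 1)) * s) ∧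
        c 0 = 1 / ((p.factorial : ℝ) * Real.pi ^ (2 * p + 1)) *
          (Real.Gamma (n + 1 / 2) * Real.Gamma (1 / 2) / Real.Gamma (n + p + 1)) *
          (∏ j ∈ Finset.range p,
            Real.Gamma (n + j + 3 / 2) * Real.Gamma (j + 3 / 2) * Real.Gamma (j + 2) /
              Real.Gamma (n + p + j + 2)) ^ 2 ∧
        c 1 = c 0 * (((n : ℝ) + p + 1 / 2) / (2 * ((n : ℝ) + 2 * p + 1) ^ 2)) *
          (4 * p * (p + 1) * (n + p + 1 / 2) + n + 2 * p + 1) := by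
  intro p
  have hm : MeasurableSet (unitCube (p + 1) ×ˢ unitCube p) :=
    (measurableSet_unitCube (p + 1)).prod (measurableSet_unitCube p)
  have hd : (n : ℝ) + 2 * p + 1 ≠ 0 := by positivity
  obtain ⟨c, hc, h0, h1⟩ := exists_hasSum_integral_coupledIntegrand (p + 1) p
    (a := n + 1 / 2) (b := 1 / 2) (a' := n + 3 / 2) (b' := 3 / 2)
    (by positivity) (by positivity) (by positivity) (by positivity)
    (e := (p + 1) * (n + p + 1 / 2) / (n + 2 * p + 1))
    (e' := p * (n + p + 1 / 2) / (n + 2 * p + 1))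
    (by push_cast; congr 1 <;> ring) (by congr 1 <;> ring)
  have heq : ∀ t : ℝ, 0 ≤ t → t < 1 → Set.EqOn (highIntegrand n p t)
      (coupledIntegrand (n + 1 / 2) (1 / 2) (n + 3 / 2) (3 / 2) t)
      (unitCube (p + 1) ×ˢ unitCube p) := fun t ht ht1 z hz =>
    highIntegrand_eq_coupledIntegrand n p ht ht1 hz
  refine ⟨fun t ht ht1 => (hc t ht ht1).1.congr_fun (heq t ht ht1).symm hm,
    fun k => 1 / ((p.factorial : ℝ) * ((p + 1).factorial : ℝ) * Real.pi ^ (2 * p + 1)) * c k,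
    fun t ht ht1 => ?_, ?_, ?_⟩
  · have hs := (hc t ht ht1).2.mul_left
      (1 / ((p.factorial : ℝ) * ((p + 1).factorial : ℝ) * Real.pi ^ (2 * p + 1)))
    simp only [← mul_assoc] at hs
    refine ⟨_, hs, ?_⟩
    rw [highFormFactor, setIntegral_congr_fun hm (heq t ht ht1)]
    ring
  · have hf : ((p + 1).factorial : ℝ) ≠ 0 := by positivity
    dsimp only
    -- The `(p+1)!` from the Selberg integral in `u` cancels the one in the prefactor.
    rw [h0, selberg_product_high, ← mul_assoc, ← mul_assoc]
    congr 2
    field_simp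
  · dsimp only
    rw [h1]
    field_simp
    ring

end IsingDiagonal

theorem mainTheorem4 (n : ℕ) :
    (∀ p : ℕ, 1 ≤ p →
      (∀ t : ℝ, 0 ≤ t → t < 1 →
        MeasureTheory.IntegrableOn (IsingDiagonal.lowIntegrand n p t)
          (IsingDiagonal.unitCube p ×ˢ IsingDiagonal.unitCube p)) ∧
      ∃ c : ℕ → ℝ,
        (∀ t : ℝ, 0 ≤ t → t < 1 → ∃ s : ℝ, HasSum (fun k : ℕ => c k * t ^ k) s ∧
          IsingDiagonal.lowFormFactor n p t = t ^ (p * (n + p)) * s) ∧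
        c 0 = 1 / ((p.factorial : ℝ) ^ 2 * Real.pi ^ (2 * p)) *
          (Real.Gamma (n + p + 1 / 2) * Real.Gamma (p + 1 / 2) /
            (Real.Gamma (n + 1 / 2) * Real.Gamma (1 / 2))) *
          (∏ j ∈ Finset.range p,
            Real.Gamma (n + j + 1 / 2) * Real.Gamma (j + 1 / 2) * Real.Gamma (j + 2) /
              Real.Gamma (n + p + j + 1)) ^ 2 ∧
        c 1 = c 0 * ((p : ℝ) * (n + p) / (2 * ((n : ℝ) + 2 * p) ^ 2)) *
          (4 * p * (n + p) + 1)) ∧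
    (∀ p : ℕ,
      (∀ t : ℝ, 0 ≤ t → t < 1 →
        MeasureTheory.IntegrableOn (IsingDiagonal.highIntegrand n p t)
          (IsingDiagonal.unitCube (p + 1) ×ˢ IsingDiagonal.unitCube p)) ∧
      ∃ c : ℕ → ℝ,
        (∀ t : ℝ, 0 ≤ t → t < 1 → ∃ s : ℝ, HasSum (fun k : ℕ => c k * t ^ k) s ∧
          IsingDiagonal.highFormFactor n p t =
            t ^ ((n : ℝ) * (p + 1 / 2) + p * (p + 1)) * s) ∧
        c 0 = 1 / ((p.factorial : ℝ) * Real.pi ^ (2 * p + 1)) *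
          (Real.Gamma (n + 1 / 2) * Real.Gamma (1 / 2) / Real.Gamma (n + p + 1)) *
          (∏ j ∈ Finset.range p,
            Real.Gamma (n + j + 3 / 2) * Real.Gamma (j + 3 / 2) * Real.Gamma (j + 2) /
              Real.Gamma (n + p + j + 2)) ^ 2 ∧
        c 1 = c 0 * (((n : ℝ) + p + 1 / 2) / (2 * ((n : ℝ) + 2 * p + 1) ^ 2)) *
          (4 * p * (p + 1) * (n + p + 1 / 2) + n + 2 * p + 1)) :=
  ⟨IsingDiagonal.lowFormFactor_expansion n, IsingDiagonal.highFormFactor_expansion n⟩
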